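/- Let $p$ be a prime, $q=p^e$ with $e\ge 1$, let $n\ge 0$ and $m\ge 1$ be integers, and let $\alpha\in\mathbb F_q$. Let $I_i$ be the set of monic irreducible polynomials of degree $i$ over $\mathbb F_q$. A polynomial is $n$-smooth if all its irreducible factors have degree at most $n$. Let $N$ be the number of monic polynomials of degree $m$ over $\mathbb F_q$ whose coefficient of $x^{m-1}$ is $\alpha$ and which have, for each $n+1\le i\le m$, no monic irreducible factor of degree $i$. Put $v(\alpha)=q\llbracket\alpha=0\rrbracket-1$, where $\llbracket P\rrbracket$ is $1$ if $P$ holds and $0$ otherwise, and $$a_i=\frac1{iq}\sum_{k\mid i,\ p\nmid k}\mu(k)q^{i/k},\qquad b_i=\frac1i\sum_{k\mid i,\ p\mid k}\mu(k)q^{i/k},$$ $$A_k(a,0)=\binom{aq/p}{k/p}(-1)^{k+k/p}\llbracket p\mid k\rrbracket,\qquad A_k(a,b)=\sum_{j=0}^{\lfloor k/p\rfloor}\binom{aq/p}{j}\binom{b}{k-pj}(-1)^{j+pj}\quad(b\ne0),$$ with generalized binomial coefficients $\binom xj=x(x-1)\cdots(x-j+1)/j!$. Then the number of monic $n$-smooth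 polynomials over $\mathbb F_q$ of the form $x^m+\alpha x^{m-1}+g(x)$, where $g\in\mathbb F_q[x]$ has degree at most $m-2$ (so $g=0$ if $m=1$), equals $N$ and is $$q^{m-1}\sum_{(j_{n+1},\dots,j_m)}\left\llbracket\sum_{i=n+1}^m ij_i\le m\right\rrbracket\prod_{i=n+1}^m q^{-ij_i}\binom{|I_i|}{j_i}(-1)^{j_i} +\frac{v(\alpha)}q\sum_{(k_{n+1},\dots,k_m)}\left\llbracket\sum_{i=n+1}^m ik_i=m\right\rrbracket\prod_{i=n+1}^m A_{k_i}(a_i,b_i)(-1)^{k_i},$$ where the first sum is over all integer tuples with $0\le j_i\le|I_i|$ and the second over all integer tuples with $k_i\ge0$. (If $n\ge m$, each sum consists of the empty tuple alone, with empty product $1$.) -/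

import Mathlib

open Polynomial

namespace SmoothCount

noncomputable section

/-- A polynomial is `n`-smooth if all its irreducible factors have degree at most `n`. -/
def IsSmooth {F : Type*} [Field F] (n : ℕ) (f : F[X]) : Prop :=
  ∀ g : F[X], Irreducible g → g ∣ f → g.natDegree ≤ n

/-- `I_i`: the monic irreducible polynomials of degree `i` over `F`. -/
def monicIrred (F : Type*) [Field F] (i : ℕ) : Set F[X] :=
  {g | g.Monic ∧ Irreducible g ∧ g.natDegree = i}

/-- `⟨f⟩_w`: the residue of `x ^ deg f * f (1 / x)` modulo `x ^ (w + 1)`. -/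
def bracket {F : Type*} [Field F] (w : ℕ) (f : F[X]) :
    F[X] ⧸ Ideal.span {(X : F[X]) ^ (w + 1)} :=
  Ideal.Quotient.mk (Ideal.span {(X : F[X]) ^ (w + 1)}) f.reverse

/-- `r_i(f)`: the number of distinct monic irreducible factors of `f` of degree `i`. -/
def numDistinct {F : Type*} [Field F] (i : ℕ) (f : F[X]) : ℕ :=
  {g ∈ monicIrred F i | g ∣ f}.ncard

/-- `N(m, ∏_{i ∈ T} I_i ^ r_i, ⟨f⟩_w)`: the number of monic `g` of degree `m` with
`⟨g⟩_w = ⟨f⟩_w` that have exactly `r_i` distinct monic irreducible factors of degree `i`, for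
every `i ∈ T`. -/
def numPattern {F : Type*} [Field F] (w m : ℕ) (T : Finset ℕ) (r : ℕ → ℕ) (f : F[X]) : ℕ :=
  {g : F[X] | g.Monic ∧ g.natDegree = m ∧ bracket w g = bracket w f ∧
    ∀ i ∈ T, numDistinct i g = r i}.ncard

/-- The monic `n`-smooth polynomials of the form `x ^ m + α x ^ (m - 1) + g(x)` with
`deg g ≤ m - 2` (so `g = 0` if `m = 1`). -/
def smoothWithTrace {F : Type*} [Field F] (n m : ℕ) (α : F) : Set F[X] :=
  {f | IsSmooth n f ∧
    ∃ g : F[X], g.degree + 2 ≤ (m : WithBot ℕ) ∧ f = X ^ m + C α * X ^ (m - 1) + g}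

/-- `a_i = (1 / (i q)) ∑ μ(k) q ^ (i / k)`, over the divisors `k` of `i` not divisible by `p`. -/
def aCoeff (p q i : ℕ) : ℚ :=
  1 / ((i : ℚ) * (q : ℚ)) *
    ∑ k ∈ i.divisors with ¬ p ∣ k, (ArithmeticFunction.moebius k : ℚ) * (q : ℚ) ^ (i / k)

/-- `b_i = (1 / i) ∑ μ(k) q ^ (i / k)`, over the divisors `k` of `i` divisible by `p`. -/
def bCoeff (p q i : ℕ) : ℚ :=
  1 / (i : ℚ) *
    ∑ k ∈ i.divisors with p ∣ k, (ArithmeticFunction.moebius k : ℚ) * (q : ℚ) ^ (i / k)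

/-- The numbers `A_k(a, b)`. The binomial coefficients are the generalized ones,
`x (x - 1) ⋯ (x - j + 1) / j!`, since `b` may be negative. -/
def numA (p q k : ℕ) (a b : ℚ) : ℚ :=
  if b = 0 then
    if p ∣ k then Ring.choose (a * q / p) (k / p) * (-1) ^ (k + k / p) else 0
  else
    ∑ j ∈ Finset.range (k / p + 1),
      Ring.choose (a * q / p) j * Ring.choose b (k - p * j) * (-1) ^ (j + p * j)

open Classical in
/-- `v(α)`, equal to `q - 1` if `α = 0` and to `-1` otherwise. -/
def traceSign {F : Type*} [Field F] (q : ℕ) (α : F) : ℚ :=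
  (q : ℚ) * (if α = 0 then 1 else 0) - 1

end

end SmoothCount

/-! Smoothness is sieved by inclusion-exclusion over sets of monic irreducibles of degrees `n + 1,
…, m`, with `D` the product of the chosen ones. The admissible multiples of `D` number `q ^ (m - 1 -
deg D)` when `deg D < m`. When `deg D = m` their number is the indicator that `D` has second
coefficient `α`, which is the expected `1 / q` plus a correction (`ncard_monicTrace_dvd`). The
expected parts depend only on how many factors of each degree are chosen, and give the first sum.

Orthogonality turns the correction into `1 / q` times a sum of `χ (-α) * χ D.nextCoeff` over
nontrivial additive characters `χ`. Second coefficients add under multiplication of monic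
polynomials, so for fixed `χ` the signed sum splits over degrees into coefficients of `∏ (1 -
χ(P.nextCoeff) X)`, with `P` in `I_i`. There are `a_i` such `P` for each nonzero second coefficient
and `a_i + b_i` for zero. Since `∏ (1 - χ(β) X)` over all `β` is `(1 - X ^ p) ^ (q / p)`, the
product is `(1 - X ^ p) ^ (a_i q / p) * (1 - X) ^ b_i`, with coefficients `(-1) ^ k A_k(a_i, b_i)`
(`prod_irredFinset_one_sub`). No `χ` is left in them, so the remaining sum of `χ (-α)` yields
`v(α)`. -/

namespace SmoothCount

/-! ### Dirichlet inversion with a weight. -/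

section Arithmetic

/-- Möbius inversion twisted by a completely multiplicative weight. -/
theorem sum_moebius_mul_of_sum_weight_mul {ε g h : ℕ → ℚ} (hε1 : ε 1 = 1)
    (hε : ∀ a b, ε (a * b) = ε a * ε b)
    (H : ∀ n, 0 < n → ∑ d ∈ n.divisorsAntidiagonal, ε d.1 * g d.2 = h n) (n : ℕ) (hn : 0 < n) :
    ∑ d ∈ n.divisorsAntidiagonal, ε d.1 * (ArithmeticFunction.moebius d.1 : ℚ) * h d.2 = g n := by
  let E : ArithmeticFunction ℚ := ⟨fun k => if k = 0 then 0 else ε k, by simp⟩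
  let M : ArithmeticFunction ℚ :=
    ⟨fun k => if k = 0 then 0 else ε k * (ArithmeticFunction.moebius k : ℚ), by simp⟩
  let G : ArithmeticFunction ℚ := ⟨fun k => if k = 0 then 0 else g k, by simp⟩
  let K : ArithmeticFunction ℚ := ⟨fun k => if k = 0 then 0 else h k, by simp⟩
  have ne : ∀ {k : ℕ} {d : ℕ × ℕ}, d ∈ k.divisorsAntidiagonal → d.1 ≠ 0 ∧ d.2 ≠ 0 := by
    intro k d hd
    rw [Nat.mem_divisorsAntidiagonal] at hd
    constructor <;> rintro h0 <;> apply hd.2 <;> rw [← hd.1, h0] <;> simp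
  have hEG : E * G = K := by
    ext k
    rcases Nat.eq_zero_or_pos k with rfl | hk
    · simp
    · rw [ArithmeticFunction.mul_apply]
      have hK : K k = h k := if_neg hk.ne'
      rw [hK, ← H k hk]
      refine Finset.sum_congr rfl fun d hd => ?_
      have h1 : E d.1 = ε d.1 := if_neg (ne hd).1
      have h2 : G d.2 = g d.2 := if_neg (ne hd).2
      rw [h1, h2]
  have hME : M * E = 1 := by
    ext k
    rcases Nat.eq_zero_or_pos k with rfl | hk
    · simp
    · have key : ∑ d ∈ k.divisorsAntidiagonal, (ArithmeticFunction.moebius d.1 : ℚ) =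
          if k = 1 then 1 else 0 := by
        have := congrArg (fun f : ArithmeticFunction ℤ => ((f k : ℤ) : ℚ))
          ArithmeticFunction.moebius_mul_coe_zeta
        simp only [ArithmeticFunction.mul_apply, ArithmeticFunction.one_apply] at this
        push_cast at this
        rw [← this]
        refine Finset.sum_congr rfl fun d hd => ?_
        simp [ArithmeticFunction.zeta_apply, (ne hd).2]
      -- Complete multiplicativity makes the weight constant on factorizations of `k`, which leaves
      -- `μ * ζ = 1`.
      have : (M * E) k = ε k * ∑ d ∈ k.divisorsAntidiagonal,
          (ArithmeticFunction.moebius d.1 : ℚ) := by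
        rw [ArithmeticFunction.mul_apply, Finset.mul_sum]
        refine Finset.sum_congr rfl fun d hd => ?_
        have h1 : M d.1 = ε d.1 * (ArithmeticFunction.moebius d.1 : ℚ) := if_neg (ne hd).1
        have h2 : E d.2 = ε d.2 := if_neg (ne hd).2
        rw [h1, h2, ← (Nat.mem_divisorsAntidiagonal.1 hd).1, hε]
        ring
      rw [this, key, ArithmeticFunction.one_apply]
      split_ifs with h1
      · rw [h1, hε1, one_mul]
      · simp
  have hMK : M * K = G := by rw [← hEG, ← mul_assoc, hME, one_mul]
  have h3 := congrArg (fun f : ArithmeticFunction ℚ => f n) hMK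
  have h4 : G n = g n := if_neg hn.ne'
  simp only [ArithmeticFunction.mul_apply] at h3
  rw [h4] at h3
  rw [← h3]
  refine Finset.sum_congr rfl fun d hd => ?_
  have h1 : M d.1 = ε d.1 * (ArithmeticFunction.moebius d.1 : ℚ) := if_neg (ne hd).1
  have h2 : K d.2 = h d.2 := if_neg (ne hd).2
  rw [h1, h2]

end Arithmetic

noncomputable section

/-! ### Traces and minimal polynomials in a finite extension. -/

section Extension

variable {F : Type*} [Field F] [Finite F]

theorem finite_natDegree_eq (m : ℕ) : {f : F[X] | f.natDegree = m}.Finite := by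
  have : Finite (degreeLT F (m + 1)) := Finite.of_equiv _ (degreeLTEquiv F (m + 1)).toEquiv.symm
  refine (Set.toFinite ((degreeLT F (m + 1) : Submodule F F[X]) : Set F[X])).subset ?_
  intro f hf
  simp only [SetLike.mem_coe, mem_degreeLT]
  refine lt_of_le_of_lt degree_le_natDegree ?_
  have hf' : f.natDegree = m := hf
  rw [hf']
  exact_mod_cast Nat.lt_succ_self m

theorem finite_monicIrred (i : ℕ) : (monicIrred F i).Finite :=
  (finite_natDegree_eq i).subset fun _ h => h.2.2

variable (F) in
/-- The monic irreducible polynomials of degree `i`, as a finset. -/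
def irredFinset (i : ℕ) : Finset F[X] := (finite_monicIrred (F := F) i).toFinset

theorem mem_irredFinset {i : ℕ} {P : F[X]} :
    P ∈ irredFinset F i ↔ P.Monic ∧ Irreducible P ∧ P.natDegree = i := by
  simp [irredFinset, monicIrred]

theorem card_irredFinset (i : ℕ) : (irredFinset F i).card = (monicIrred F i).ncard :=
  (Set.ncard_eq_toFinset_card _ _).symm

open Classical in
/-- The number of monic irreducible polynomials of degree `i` with second coefficient `β`. -/
def irredCount (i : ℕ) (β : F) : ℕ := ((irredFinset F i).filter fun P => P.nextCoeff = β).card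

variable {K : Type*} [Field K] [Algebra F K]

open Classical in
-- The trace is additive and surjective, so its fibres are equinumerous. The sign matches that of
-- the second coefficient.
theorem card_trace_fiber [Fintype K] (β : F) :
    Nat.card F * (Finset.univ.filter fun x : K => -Algebra.trace F K x = β).card =
      Nat.card K := by
  have : Fintype F := Fintype.ofFinite F
  let f : K →+ F := -(Algebra.trace F K).toAddMonoidHom
  have hsurj : Function.Surjective f := fun b => by
    obtain ⟨x, hx⟩ := Algebra.trace_surjective F K (-b)
    exact ⟨x, by simp [f, hx]⟩
  have h1 : ∀ b : F, (Finset.univ.filter fun x : K => -Algebra.trace F K x = b).card =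
      (Finset.univ.filter fun x : K => -Algebra.trace F K x = β).card := fun b =>
    AddMonoidHom.card_fiber_eq_of_mem_range f (hsurj b) (hsurj β)
  have h2 := Finset.card_eq_sum_card_fiberwise (s := (Finset.univ : Finset K))
    (t := (Finset.univ : Finset F)) (f := fun x => -Algebra.trace F K x) (by simp [Set.MapsTo])
  rw [Finset.sum_congr rfl fun b _ => h1 b] at h2
  rw [Nat.card_eq_fintype_card, Nat.card_eq_fintype_card, ← Finset.card_univ (α := K), h2]
  simp

omit [Finite F] in
theorem neg_trace_eq_nsmul_nextCoeff [FiniteDimensional F K] (x : K) :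
    -Algebra.trace F K x =
      (Module.finrank F K / (minpoly F x).natDegree : ℕ) * (minpoly F x).nextCoeff := by
  have hx : IsIntegral F x := Algebra.IsIntegral.isIntegral x
  have h1 := Module.finrank_mul_finrank F (IntermediateField.adjoin F {x}) K
  rw [IntermediateField.adjoin.finrank hx] at h1
  rw [trace_eq_finrank_mul_minpoly_nextCoeff, ← h1, Nat.mul_div_cancel_left _
    (minpoly.natDegree_pos hx)]
  ring

open Classical in
-- `P` divides `X ^ |K| - X`, which splits in `K`, and `P` is separable because `F` is perfect; the
-- elements counted are its roots.
theorem card_minpoly_eq [Fintype K] {P : F[X]} (hP : P.Monic) (hirr : Irreducible P)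
    (hd : P.natDegree ∣ Module.finrank F K) :
    (Finset.univ.filter fun x : K => minpoly F x = P).card = P.natDegree := by
  have hsep : P.Separable := PerfectField.separable_of_irreducible hirr
  have hsplit : (P.map (algebraMap F K)).Splits := by
    have hdvd := (hirr.natDegree_dvd_iff_dvd_X_pow_card_pow_sub_X).1 hd
    have hc : Nat.card F ^ Module.finrank F K = Fintype.card K := by
      rw [← Nat.card_eq_fintype_card]; exact (Module.natCard_eq_pow_finrank (K := F) (V := K)).symm
    have h1 := Polynomial.map_dvd (algebraMap F K) hdvd
    rw [hc] at h1
    refine Splits.of_dvd (g := (X ^ Fintype.card K - X : F[X]).map (algebraMap F K)) ?_ ?_ h1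
    · rw [← Nat.card_eq_fintype_card]
      simpa using Polynomial.splits_X_pow_nat_card_sub_X (K := K)
    · exact (Polynomial.map_ne_zero_iff (algebraMap F K).injective).2
        (FiniteField.X_pow_card_sub_X_ne_zero F Fintype.one_lt_card)
  rw [← card_rootSet_eq_natDegree hsep hsplit, ← Set.toFinset_card]
  congr 1
  ext x
  simp only [Finset.mem_filter, Finset.mem_univ, true_and, Set.mem_toFinset, mem_rootSet,
    hirr.ne_zero, ne_eq, not_false_eq_true]
  constructor
  · rintro rfl; exact minpoly.aeval F x
  · intro h; exact (minpoly.eq_of_irreducible_of_monic hirr h hP).symm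

open Classical in
-- The elements of `K` with trace `-β` are sorted by minimal polynomial.
theorem sum_divisors_card_irred [Fintype K] (β : F) :
    Nat.card F * ∑ i ∈ (Module.finrank F K).divisors, i *
      ((irredFinset F i).filter fun P =>
        ((Module.finrank F K / i : ℕ) : F) * P.nextCoeff = β).card = Nat.card K := by
  rw [← card_trace_fiber (K := K) β]
  congr 1
  have hN : Module.finrank F K ≠ 0 := Module.finrank_pos.ne'
  have hint : ∀ x : K, IsIntegral F x := fun x => Algebra.IsIntegral.isIntegral x
  rw [Finset.card_eq_sum_card_fiberwise (t := (Module.finrank F K).divisors)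
    (f := fun x : K => (minpoly F x).natDegree)]
  · refine Finset.sum_congr rfl fun i hi => ?_
    rw [Finset.card_eq_sum_card_fiberwise (f := fun x : K => minpoly F x)
      (t := (irredFinset F i).filter fun P =>
        ((Module.finrank F K / i : ℕ) : F) * P.nextCoeff = β)]
    · rw [mul_comm, ← smul_eq_mul, ← Finset.sum_const]
      refine Finset.sum_congr rfl fun P hP => ?_
      rw [Finset.mem_filter, mem_irredFinset] at hP
      obtain ⟨⟨hm, hirr, rfl⟩, hβ⟩ := hP
      refine (card_minpoly_eq (K := K) hm hirr (Nat.dvd_of_mem_divisors hi)).symm.trans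
        (congrArg Finset.card ?_)
      ext x
      simp only [Finset.mem_filter, Finset.mem_univ, true_and]
      constructor
      · rintro rfl
        exact ⟨⟨(neg_trace_eq_nsmul_nextCoeff x).trans hβ, rfl⟩, rfl⟩
      · exact fun h => h.2
    · intro x hx
      simp only [Finset.coe_filter, Finset.mem_filter, Finset.mem_univ, true_and,
        Set.mem_ofPred_eq, mem_irredFinset] at hx ⊢
      refine ⟨⟨minpoly.monic (hint x), minpoly.irreducible (hint x), hx.2⟩, ?_⟩
      rw [← hx.2, ← hx.1, neg_trace_eq_nsmul_nextCoeff x]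
  · intro x _
    simp only [Finset.mem_coe, Nat.mem_divisors]
    exact ⟨minpoly.degree_dvd (hint x), hN⟩

end Extension

/-! ### Irreducible polynomials with prescribed second coefficient. -/

section IrredCount

variable {F : Type*} [Field F] [Finite F]

open Classical in
theorem sum_divisors_mul_card_irred {p : ℕ} (hp : p.Prime) [CharP F p] {N : ℕ} (hN : 0 < N)
    (β : F) :
    Nat.card F * ∑ i ∈ N.divisors, i *
      ((irredFinset F i).filter fun P => ((N / i : ℕ) : F) * P.nextCoeff = β).card =
        Nat.card F ^ N := by
  have : Fact p.Prime := ⟨hp⟩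
  have : NeZero N := ⟨hN.ne'⟩
  have : Finite (FiniteField.Extension F p N) := Module.finite_of_finite F
  have : Fintype (FiniteField.Extension F p N) := Fintype.ofFinite _
  have h := sum_divisors_card_irred (F := F) (K := FiniteField.Extension F p N) β
  rwa [FiniteField.finrank_extension, FiniteField.natCard_extension] at h

theorem sum_antidiagonal_card_irredFinset {p : ℕ} (hp : p.Prime) [CharP F p] {N : ℕ}
    (hN : 0 < N) :
    ∑ d ∈ N.divisorsAntidiagonal, d.2 * (irredFinset F d.2).card = Nat.card F ^ N := by
  classical
  have : Fintype F := Fintype.ofFinite F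
  have hq : 0 < Nat.card F := Nat.card_pos
  have h := Finset.sum_congr rfl fun (β : F) (_ : β ∈ Finset.univ) =>
    sum_divisors_mul_card_irred hp hN β
  rw [← Finset.mul_sum, Finset.sum_comm, Finset.sum_const, smul_eq_mul, Finset.card_univ,
    ← Nat.card_eq_fintype_card] at h
  rw [Nat.sum_divisorsAntidiagonal' (f := fun _ i => i * (irredFinset F i).card),
    ← Nat.eq_of_mul_eq_mul_left hq h]
  refine Finset.sum_congr rfl fun i _ => ?_
  rw [← Finset.mul_sum, Finset.card_eq_sum_card_fiberwise (t := (Finset.univ : Finset F))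
    (f := fun P => ((N / i : ℕ) : F) * P.nextCoeff) (by simp [Set.MapsTo])]

/-- If `p` divides the cofactor `d`, then `d * P.nextCoeff = 0` cannot equal `β`; otherwise `d` is
invertible in `F`. -/
theorem sum_antidiagonal_irredCount {p : ℕ} (hp : p.Prime) [CharP F p] {N : ℕ}
    (hN : 0 < N) {β : F} (hβ : β ≠ 0) :
    Nat.card F * ∑ d ∈ N.divisorsAntidiagonal,
      (if p ∣ d.1 then 0 else d.2 * irredCount d.2 ((d.1 : F)⁻¹ * β)) = Nat.card F ^ N := by
  classical
  rw [← sum_divisors_mul_card_irred hp hN β,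
    Nat.sum_divisorsAntidiagonal'
      (f := fun d i => if p ∣ d then 0 else i * irredCount i ((d : F)⁻¹ * β))]
  congr 1
  refine Finset.sum_congr rfl fun i _ => ?_
  split_ifs with h
  · rw [(CharP.cast_eq_zero_iff F p _).2 h]
    simp [hβ.symm]
  · have h0 : ((N / i : ℕ) : F) ≠ 0 := fun h' => h ((CharP.cast_eq_zero_iff F p _).1 h')
    rw [irredCount]
    congr 3
    ext P
    rw [eq_inv_mul_iff_mul_eq₀ h0]

/-- In the divisor identities for `β` and for `1`, induction matches all terms of degree below `N`,
so the terms of degree `N` agree too. -/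
theorem irredCount_eq_one {p : ℕ} (hp : p.Prime) [CharP F p] {N : ℕ} (hN : 0 < N) {β : F}
    (hβ : β ≠ 0) : irredCount N β = irredCount N (1 : F) := by
  induction N using Nat.strong_induction_on generalizing β with
  | _ N ih =>
  have hq : 0 < Nat.card F := Nat.card_pos
  have h := (sum_antidiagonal_irredCount hp hN hβ).trans
    (sum_antidiagonal_irredCount hp hN (one_ne_zero (α := F))).symm
  have h := Nat.eq_of_mul_eq_mul_left hq h
  have hmem : (1, N) ∈ N.divisorsAntidiagonal := by simp [hN.ne']
  rw [← Finset.add_sum_erase _ _ hmem, ← Finset.add_sum_erase _ _ hmem] at h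
  have hrest : ∑ d ∈ N.divisorsAntidiagonal.erase (1, N),
      (if p ∣ d.1 then 0 else d.2 * irredCount d.2 ((d.1 : F)⁻¹ * β)) =
      ∑ d ∈ N.divisorsAntidiagonal.erase (1, N),
      (if p ∣ d.1 then 0 else d.2 * irredCount d.2 ((d.1 : F)⁻¹ * 1)) := by
    refine Finset.sum_congr rfl fun d hd => ?_
    rw [Finset.mem_erase, Nat.mem_divisorsAntidiagonal] at hd
    obtain ⟨hne, hd, -⟩ := hd
    split_ifs with hpd
    · rfl
    have h0 : ((d.1 : ℕ) : F) ≠ 0 := fun h' => hpd ((CharP.cast_eq_zero_iff F p _).1 h')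
    have hd1 : d.1 ≠ 0 := fun h' => h0 (by rw [h']; simp)
    have hd2 : 0 < d.2 := Nat.pos_of_ne_zero fun h' => by rw [h'] at hd; omega
    have hlt : d.2 < N := by
      rw [← hd]
      refine lt_mul_of_one_lt_left hd2 ?_
      refine lt_of_le_of_ne (Nat.pos_of_ne_zero hd1) fun h1 => hne ?_
      rw [← h1, one_mul] at hd
      exact Prod.ext h1.symm hd
    rw [ih d.2 hlt hd2 (mul_ne_zero (inv_ne_zero h0) hβ),
      ih d.2 hlt hd2 (mul_ne_zero (inv_ne_zero h0) one_ne_zero)]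
  rw [hrest] at h
  simp only [hp.one_lt.ne', Nat.dvd_one, if_false, Nat.cast_one, inv_one, one_mul] at h
  exact Nat.eq_of_mul_eq_mul_left hN (Nat.add_right_cancel h)

/-- Independence of `β` makes the divisor identity a convolution with the indicator of `p ∤ d`,
completely multiplicative as `p` is prime. -/
theorem irredCount_eq_aCoeff {p : ℕ} (hp : p.Prime) [CharP F p] {N : ℕ} (hN : 0 < N) {β : F}
    (hβ : β ≠ 0) : (irredCount N β : ℚ) = aCoeff p (Nat.card F) N := by
  rw [irredCount_eq_one hp hN hβ]
  have hq : (Nat.card F : ℚ) ≠ 0 := Nat.cast_ne_zero.2 Nat.card_pos.ne'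
  have h := sum_moebius_mul_of_sum_weight_mul (ε := fun d => if p ∣ d then 0 else 1)
    (g := fun i => (i : ℚ) * irredCount i (1 : F))
    (h := fun n => (Nat.card F : ℚ) ^ n / Nat.card F) (by simp [hp.one_lt.ne'])
    (by
      intro a b
      simp only [hp.dvd_mul]
      by_cases ha : p ∣ a <;> by_cases hb : p ∣ b <;> simp [ha, hb])
    (by
      intro n hn
      rw [eq_div_iff hq, mul_comm]
      have := congrArg (Nat.cast (R := ℚ))
        (sum_antidiagonal_irredCount hp hn (one_ne_zero (α := F)))
      push_cast at this
      rw [← this]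
      congr 1
      refine Finset.sum_congr rfl fun d hd => ?_
      rw [Nat.mem_divisorsAntidiagonal] at hd
      split_ifs with hpd
      · simp
      have h0 : ((d.1 : ℕ) : F) ≠ 0 := fun h' => hpd ((CharP.cast_eq_zero_iff F p _).1 h')
      have hd2 : 0 < d.2 := Nat.pos_of_ne_zero fun h' => by
        rw [h'] at hd; exact hd.2 (by rw [← hd.1]; simp)
      rw [irredCount_eq_one hp hd2 (mul_ne_zero (inv_ne_zero h0) one_ne_zero), one_mul])
    N hN
  have hN' : (N : ℚ) ≠ 0 := Nat.cast_ne_zero.2 hN.ne'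
  rw [← mul_right_inj' hN', ← h, aCoeff,
    Nat.sum_divisorsAntidiagonal
      (f := fun d i => (if p ∣ d then 0 else 1) * (ArithmeticFunction.moebius d : ℚ) *
        ((Nat.card F : ℚ) ^ i / Nat.card F)), Finset.sum_filter, ← mul_assoc, Finset.mul_sum]
  refine Finset.sum_congr rfl fun d _ => ?_
  by_cases hd : p ∣ d
  · simp [hd]
  · simp only [hd, if_false, not_false_eq_true, if_true]
    field_simp

theorem card_irredFinset_eq {p : ℕ} (hp : p.Prime) [CharP F p] {N : ℕ} (hN : 0 < N) :
    ((irredFinset F N).card : ℚ) =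
      Nat.card F * aCoeff p (Nat.card F) N + bCoeff p (Nat.card F) N := by
  have hq : (Nat.card F : ℚ) ≠ 0 := Nat.cast_ne_zero.2 Nat.card_pos.ne'
  have hN' : (N : ℚ) ≠ 0 := Nat.cast_ne_zero.2 hN.ne'
  have h := sum_moebius_mul_of_sum_weight_mul (ε := fun _ => 1)
    (g := fun i => (i : ℚ) * (irredFinset F i).card)
    (h := fun n => (Nat.card F : ℚ) ^ n) rfl (by simp)
    (by
      intro n hn
      have := congrArg (Nat.cast (R := ℚ)) (sum_antidiagonal_card_irredFinset (F := F) hp hn)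
      push_cast at this
      rw [← this]
      exact Finset.sum_congr rfl fun d _ => one_mul _)
    N hN
  rw [← mul_right_inj' hN', ← h, aCoeff, bCoeff,
    Nat.sum_divisorsAntidiagonal
      (f := fun d i => 1 * (ArithmeticFunction.moebius d : ℚ) * (Nat.card F : ℚ) ^ i),
    ← Finset.sum_filter_add_sum_filter_not N.divisors (fun d => p ∣ d)]
  simp only [one_mul]
  field_simp
  ring

/-- The `q - 1` nonzero classes, `a` each, are removed from the total `q a + b`. -/
theorem irredCount_zero_eq {p : ℕ} (hp : p.Prime) [CharP F p] {N : ℕ} (hN : 0 < N) :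
    (irredCount N (0 : F) : ℚ) = aCoeff p (Nat.card F) N + bCoeff p (Nat.card F) N := by
  classical
  have : Fintype F := Fintype.ofFinite F
  have h1 : (irredFinset F N).card = ∑ β : F, irredCount N β :=
    Finset.card_eq_sum_card_fiberwise (by simp [Set.MapsTo])
  have h2 := congrArg (Nat.cast (R := ℚ)) h1
  rw [card_irredFinset_eq hp hN, ← Finset.add_sum_erase _ _ (Finset.mem_univ (0 : F))] at h2
  push_cast at h2
  rw [Finset.sum_congr rfl fun β hβ => irredCount_eq_aCoeff hp hN (Finset.ne_of_mem_erase hβ),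
    Finset.sum_const, Finset.card_erase_of_mem (Finset.mem_univ _), Finset.card_univ,
    ← Nat.card_eq_fintype_card, nsmul_eq_mul, Nat.cast_pred Nat.card_pos] at h2
  linarith

end IrredCount


/-! ### Products over a nontrivial additive character. -/

section CharacterProduct

open Classical in
-- A nontrivial `χ` takes every `p`-th root of unity as a value equally often, and `∏ (1 - ζ y) = 1
-- - y ^ p` over these roots. `R` is general so that `y` can be a power series variable.
theorem prod_one_sub_addChar_mul {F R : Type*} [Field F] [Fintype F] [CommRing R] [IsDomain R]
    {p : ℕ} (hp : p.Prime) [CharP F p] {χ : AddChar F R} (hχ : χ ≠ 1) (y : R) :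
    ∏ β : F, (1 - χ β * y) = (1 - y ^ p) ^ (Fintype.card F / p) := by
  obtain ⟨β₀, hβ₀⟩ := (AddChar.ne_one_iff).1 hχ
  have hpow : ∀ β, χ β ^ p = 1 := fun β => by
    rw [← AddChar.map_nsmul_eq_pow, nsmul_eq_mul, CharP.cast_eq_zero, zero_mul,
      AddChar.map_zero_eq_one]
  have hζ : IsPrimitiveRoot (χ β₀) p := by
    have : orderOf (χ β₀) = p := @orderOf_eq_prime _ _ _ p ⟨hp⟩ (hpow β₀) hβ₀
    rw [← this]
    exact IsPrimitiveRoot.orderOf _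
  have hmaps : ∀ β ∈ (Finset.univ : Finset F), χ β ∈ nthRootsFinset p (1 : R) := fun β _ => by
    rw [mem_nthRootsFinset hp.pos]
    exact hpow β
  have hfib : ∀ z ∈ nthRootsFinset p (1 : R),
      (Finset.univ.filter fun β : F => χ β = z).card =
        (Finset.univ.filter fun β : F => χ β = 1).card := by
    intro z hz
    rw [mem_nthRootsFinset hp.pos] at hz
    have : NeZero p := ⟨hp.ne_zero⟩
    obtain ⟨k, -, rfl⟩ := hζ.eq_pow_of_pow_eq_one hz
    have hu : χ (k • β₀) ≠ 0 := fun h => by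
      have := hpow (k • β₀)
      rw [h, zero_pow hp.ne_zero] at this
      exact zero_ne_one this
    rw [← AddChar.map_nsmul_eq_pow]
    symm
    refine Finset.card_bij (fun β _ => β + k • β₀) ?_ ?_ ?_
    · intro β hβ
      simp only [Finset.mem_filter, Finset.mem_univ, true_and] at hβ ⊢
      rw [AddChar.map_add_eq_mul, hβ, one_mul]
    · intro a _ b _ h
      exact add_right_cancel h
    · intro β hβ
      simp only [Finset.mem_filter, Finset.mem_univ, true_and] at hβ
      refine ⟨β - k • β₀, ?_, sub_add_cancel _ _⟩
      simp only [Finset.mem_filter, Finset.mem_univ, true_and]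
      have h := AddChar.map_add_eq_mul χ (β - k • β₀) (k • β₀)
      rw [sub_add_cancel, hβ] at h
      exact (mul_right_cancel₀ hu (by rw [one_mul]; exact h)).symm
  have hcard := Finset.card_eq_sum_card_fiberwise hmaps
  rw [Finset.sum_congr rfl hfib, Finset.sum_const, hζ.card_nthRootsFinset, smul_eq_mul,
    Finset.card_univ] at hcard
  rw [hcard, Nat.mul_div_cancel_left _ hp.pos, ← Finset.prod_fiberwise_of_maps_to hmaps]
  have hprod := hζ.pow_sub_pow_eq_prod_sub_mul 1 y hp.pos
  rw [one_pow] at hprod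
  rw [hprod, ← Finset.prod_pow]
  refine Finset.prod_congr rfl fun z hz => ?_
  rw [← hfib z hz, ← Finset.prod_const]
  refine Finset.prod_congr rfl fun β hβ => ?_
  rw [(Finset.mem_filter.1 hβ).2]

/-- The case `b = 0` is not exceptional: `Ring.choose 0 (k - p * j)` vanishes unless `p * j = k`. -/
theorem numA_eq_sum {p : ℕ} (hp : 0 < p) (q k : ℕ) (a b : ℚ) :
    numA p q k a b = ∑ j ∈ Finset.range (k / p + 1),
      Ring.choose (a * q / p) j * Ring.choose b (k - p * j) * (-1) ^ (j + p * j) := by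
  rw [numA]
  split_ifs with hb hk
  · obtain ⟨l, rfl⟩ := hk
    rw [Nat.mul_div_cancel_left _ hp, Finset.sum_range_succ, Finset.sum_eq_zero]
    · simp [hb, add_comm]
    · intro j hj
      rw [Finset.mem_range] at hj
      rw [hb, Ring.choose_zero_pos _ (Nat.sub_pos_of_lt ((Nat.mul_lt_mul_left hp).2 hj))]
      simp
  · symm
    refine Finset.sum_eq_zero fun j hj => ?_
    rw [Finset.mem_range, Nat.lt_succ_iff, Nat.le_div_iff_mul_le hp] at hj
    have : 0 < k - p * j := by
      refine Nat.sub_pos_of_lt (lt_of_le_of_ne (by rwa [mul_comm]) fun h => hk ⟨j, h.symm⟩)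
    rw [hb, Ring.choose_zero_pos _ this]
    simp
  · rfl

theorem coeff_one_sub_X_pow_mul_binomialSeries {p : ℕ} (hp : 0 < p) (q k M : ℕ) (B : ℤ) {a b : ℚ}
    (ha : a * q / p = M) (hb : b = B) :
    PowerSeries.coeff k ((1 - (PowerSeries.X : PowerSeries ℂ) ^ p) ^ M *
      PowerSeries.rescale (-1 : ℂ) (PowerSeries.binomialSeries ℂ B)) =
        ((numA p q k a b * (-1) ^ k : ℚ) : ℂ) := by
  have hB : ∀ l, ((Ring.choose b l : ℚ) : ℂ) = (Ring.choose B l : ℤ) := fun l => by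
    have := Ring.map_choose (Int.castRingHom ℚ) B l
    rw [eq_intCast, eq_intCast, ← hb] at this
    rw [← this]
    simp
  rw [numA_eq_sum hp, ha, sub_eq_neg_add, add_pow, Finset.sum_mul, map_sum, Finset.sum_mul]
  have hterm : ∀ j, PowerSeries.coeff k ((-(PowerSeries.X : PowerSeries ℂ) ^ p) ^ j * 1 ^ (M - j) *
      (M.choose j : PowerSeries ℂ) *
        PowerSeries.rescale (-1 : ℂ) (PowerSeries.binomialSeries ℂ B)) =
      if p * j ≤ k then ((Ring.choose (M : ℚ) j * Ring.choose b (k - p * j) * (-1) ^ (j + p * j) *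
        (-1) ^ k : ℚ) : ℂ) else 0 := by
    intro j
    have h1 : (-(PowerSeries.X : PowerSeries ℂ) ^ p) ^ j * 1 ^ (M - j) *
      (M.choose j : PowerSeries ℂ) *
        PowerSeries.rescale (-1 : ℂ) (PowerSeries.binomialSeries ℂ B) =
        PowerSeries.X ^ (p * j) * (PowerSeries.C ((-1) ^ j * (M.choose j : ℂ)) *
          PowerSeries.rescale (-1 : ℂ) (PowerSeries.binomialSeries ℂ B)) := by
      rw [neg_pow, ← pow_mul, map_mul, map_pow, map_neg, map_one, map_natCast]
      ring
    rw [h1, PowerSeries.coeff_X_pow_mul']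
    split_ifs with hj
    · rw [PowerSeries.coeff_C_mul, PowerSeries.coeff_rescale, PowerSeries.binomialSeries_coeff,
        Ring.choose_natCast]
      push_cast
      rw [hB, zsmul_eq_mul, mul_one]
      obtain ⟨l, rfl⟩ := Nat.exists_eq_add_of_le hj
      rw [Nat.add_sub_cancel_left, pow_add (-1 : ℂ) (p * j) l, pow_add (-1 : ℂ) j (p * j)]
      have : ((-1 : ℂ) ^ (p * j)) * ((-1 : ℂ) ^ (p * j)) = 1 := by
        rw [← mul_pow]; simp
      linear_combination (-(-1 : ℂ) ^ j * (M.choose j : ℂ) * (-1) ^ l * (Ring.choose B l : ℤ)) * this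
    · rfl
  rw [Finset.sum_congr rfl fun j _ => hterm j]
  rw [Rat.cast_sum]
  -- Both ranges are enlarged to a common one: terms with `j > M` have zero binomial, those with `p
  -- * j > k` have too high a degree.
  have hL : Finset.range (M + 1) ⊆ Finset.range (M + k / p + 1) :=
    Finset.range_subset_range.2 (Nat.succ_le_succ (Nat.le_add_right _ _))
  have hR : Finset.range (k / p + 1) ⊆ Finset.range (M + k / p + 1) :=
    Finset.range_subset_range.2 (Nat.succ_le_succ (Nat.le_add_left _ _))
  rw [Finset.sum_subset hL, ← Finset.sum_subset_zero_on_sdiff hR]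
  · intro j hj
    rw [Finset.mem_sdiff, Finset.mem_range, Finset.mem_range, Nat.lt_succ_iff,
      Nat.lt_succ_iff, Nat.le_div_iff_mul_le hp] at hj
    rw [if_neg (by rw [mul_comm]; exact hj.2)]
  · intro j hj
    rw [Finset.mem_range, Nat.lt_succ_iff, Nat.le_div_iff_mul_le hp] at hj
    rw [if_pos (by rwa [mul_comm])]
  · intro j _ hj
    rw [Finset.mem_range, not_lt] at hj
    rw [Ring.choose_natCast, Nat.choose_eq_zero_of_lt (by omega)]
    simp

variable {F : Type*} [Field F] [Finite F]

theorem prod_irredFinset_one_sub {p e : ℕ} (hp : p.Prime) (he : 0 < e) (hF : Nat.card F = p ^ e)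
    [CharP F p] {χ : AddChar F ℂ} (hχ : χ ≠ 1) {i : ℕ} (hi : 0 < i) (k : ℕ) :
    PowerSeries.coeff k
      (∏ P ∈ irredFinset F i, (1 - PowerSeries.C (χ P.nextCoeff) * PowerSeries.X)) =
        ((numA p (Nat.card F) k (aCoeff p (Nat.card F) i) (bCoeff p (Nat.card F) i) *
          (-1) ^ k : ℚ) : ℂ) := by
  classical
  have : Fintype F := Fintype.ofFinite F
  set A := irredCount i (1 : F)
  set Z := irredCount i (0 : F)
  have hA : aCoeff p (Nat.card F) i = A := (irredCount_eq_aCoeff hp hi one_ne_zero).symm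
  have hZ : bCoeff p (Nat.card F) i = ((Z : ℤ) - (A : ℤ) : ℤ) := by
    have := irredCount_zero_eq (F := F) hp hi
    push_cast
    rw [← hA]
    linarith
  have hdiv : p ∣ Nat.card F := hF ▸ dvd_pow_self p he.ne'
  have hp0 : (p : ℚ) ≠ 0 := Nat.cast_ne_zero.2 hp.ne_zero
  rw [← coeff_one_sub_X_pow_mul_binomialSeries (p := p) hp.pos (Nat.card F) k
    (Nat.card F / p * A) ((Z : ℤ) - (A : ℤ)) _ hZ]
  swap
  · rw [hA]
    push_cast
    rw [Nat.cast_div hdiv hp0]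
    ring
  congr 1
  have hprod : ∏ P ∈ irredFinset F i, (1 - PowerSeries.C (χ P.nextCoeff) * PowerSeries.X) =
      ∏ β : F, (1 - PowerSeries.C (χ β) * PowerSeries.X) ^ irredCount i β := by
    rw [← Finset.prod_fiberwise_of_maps_to (t := Finset.univ) (g := fun P : F[X] => P.nextCoeff)
      (fun _ _ => Finset.mem_univ _)]
    refine Finset.prod_congr rfl fun β _ => ?_
    rw [irredCount, ← Finset.prod_const]
    refine Finset.prod_congr rfl fun P hP => ?_
    rw [(Finset.mem_filter.1 hP).2]
  have hcount : ∀ β : F, β ≠ 0 → irredCount i β = A := fun β hβ => irredCount_eq_one hp hi hβ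
  have hone : (1 - PowerSeries.C (χ 0) * PowerSeries.X : PowerSeries ℂ) =
      PowerSeries.rescale (-1 : ℂ) (1 + PowerSeries.X) := by
    simp [PowerSeries.rescale_X, sub_eq_add_neg]
  have hbin : ∀ n : ℕ, (1 - PowerSeries.C (χ 0) * PowerSeries.X : PowerSeries ℂ) ^ n =
      PowerSeries.rescale (-1 : ℂ) (PowerSeries.binomialSeries ℂ (n : ℤ)) := fun n => by
    rw [hone, ← map_pow, PowerSeries.binomialSeries_nat]
  let χ' : AddChar F (PowerSeries ℂ) :=
    (PowerSeries.C : ℂ →+* PowerSeries ℂ).toMonoidHom.compAddChar χ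
  have hχ' : χ' ≠ 1 := by
    obtain ⟨β₀, hβ₀⟩ := (AddChar.ne_one_iff).1 hχ
    refine (AddChar.ne_one_iff).2 ⟨β₀, fun h => hβ₀ ?_⟩
    exact PowerSeries.C_injective (h.trans (map_one _).symm)
  have hall := prod_one_sub_addChar_mul hp hχ' (PowerSeries.X : PowerSeries ℂ)
  -- `A` of the factors at `β = 0` complete the product over all of `F`. The exponent `Z - A` left
  -- over may be negative, hence binomial series instead of powers.
  have hZA : PowerSeries.binomialSeries ℂ (Z : ℤ) =
      PowerSeries.binomialSeries ℂ (A : ℤ) * PowerSeries.binomialSeries ℂ ((Z : ℤ) - A) := by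
    rw [← PowerSeries.binomialSeries_add, add_sub_cancel]
  rw [hprod, ← Finset.mul_prod_erase _ _ (Finset.mem_univ (0 : F)), hbin, hZA,
    map_mul, ← hbin, pow_mul, Nat.card_eq_fintype_card, ← hall,
    ← Finset.prod_pow, ← Finset.mul_prod_erase _ _ (Finset.mem_univ (0 : F)),
    Finset.prod_congr rfl fun β hβ => by rw [hcount β (Finset.ne_of_mem_erase hβ)]]
  simp only [χ', MonoidHom.compAddChar_apply, Function.comp]
  change _ = (1 - PowerSeries.C (χ 0) * PowerSeries.X) ^ A *
    (∏ β ∈ Finset.univ.erase 0, (1 - PowerSeries.C (χ β) * PowerSeries.X) ^ A) * _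
  ring

theorem coeff_prod_one_sub_C_mul_X {ι R : Type*} [CommRing R] (s : Finset ι)
    (c : ι → R) (k : ℕ) :
    PowerSeries.coeff k (∏ P ∈ s, (1 - PowerSeries.C (c P) * PowerSeries.X)) =
      ∑ t ∈ s.powersetCard k, ∏ P ∈ t, -c P := by
  classical
  have h : ∏ P ∈ s, (1 - PowerSeries.C (c P) * PowerSeries.X) =
      ∏ P ∈ s, (1 + PowerSeries.C (-c P) * PowerSeries.X) :=
    Finset.prod_congr rfl fun P _ => by rw [map_neg, neg_mul, sub_eq_add_neg]
  rw [h, Finset.prod_one_add, map_sum, Finset.powersetCard_eq_filter,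
    Finset.sum_filter]
  refine Finset.sum_congr rfl fun t _ => ?_
  rw [Finset.prod_mul_distrib, Finset.prod_const, ← map_prod, PowerSeries.coeff_C_mul,
    PowerSeries.coeff_X_pow]
  simp [eq_comm]

end CharacterProduct


/-! ### Monic polynomials with prescribed second coefficient, and their multiples. -/

section MonicCount

variable {F : Type*} [Field F]

/-- The monic polynomials of degree `m` with second coefficient `α`. -/
def monicTrace (m : ℕ) (α : F) : Set F[X] :=
  {f | f.Monic ∧ f.natDegree = m ∧ f.nextCoeff = α}

theorem degree_add_two_le_iff {m : ℕ} (hm : 1 ≤ m) (g : F[X]) :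
    g.degree + 2 ≤ (m : WithBot ℕ) ↔ g.degree < ((m - 1 : ℕ) : WithBot ℕ) := by
  rcases eq_or_ne g 0 with rfl | hg
  · simp
  · rw [degree_eq_natDegree hg]
    norm_cast
    omega

theorem mem_monicTrace_iff {m : ℕ} (hm : 1 ≤ m) (α : F) (f : F[X]) :
    f ∈ monicTrace m α ↔
      ∃ g : F[X], g.degree + 2 ≤ (m : WithBot ℕ) ∧ f = X ^ m + C α * X ^ (m - 1) + g := by
  constructor
  · rintro ⟨h1, h2, h3⟩
    refine ⟨f - (X ^ m + C α * X ^ (m - 1)), ?_, by ring⟩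
    rw [degree_add_two_le_iff hm, degree_lt_iff_coeff_zero]
    intro k hk
    rw [nextCoeff_of_natDegree_pos (by omega), h2] at h3
    rw [coeff_sub, coeff_add, coeff_X_pow, coeff_C_mul, coeff_X_pow]
    rcases lt_trichotomy k m with hlt | rfl | hgt
    · obtain rfl : k = m - 1 := by omega
      rw [h3]
      simp [show ¬ (m - 1 = m) by omega]
    · have : f.coeff k = 1 := by rw [← h2]; exact h1
      simp [this, show ¬ (k = k - 1) by omega]
    · rw [coeff_eq_zero_of_natDegree_lt (by omega)]
      simp [show ¬ (k = m - 1) by omega, hgt.ne']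
  · rintro ⟨g, hg, rfl⟩
    rw [degree_add_two_le_iff hm] at hg
    have hdeg : (C α * X ^ (m - 1) + g).degree < ((m : ℕ) : WithBot ℕ) := by
      refine lt_of_le_of_lt (degree_add_le _ _) (max_lt ?_ ?_)
      · refine lt_of_le_of_lt (degree_C_mul_X_pow_le _ _) ?_
        exact_mod_cast (by omega : m - 1 < m)
      · refine hg.trans ?_
        exact_mod_cast (by omega : m - 1 < m)
    have hmon : (X ^ m + C α * X ^ (m - 1) + g).Monic := by
      rw [add_assoc]
      exact monic_X_pow_add hdeg
    have hnat : (X ^ m + C α * X ^ (m - 1) + g).natDegree = m := by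
      rw [add_assoc]
      exact natDegree_eq_of_degree_eq_some (by
        rw [degree_add_eq_left_of_degree_lt (by rwa [degree_X_pow]), degree_X_pow])
    refine ⟨hmon, hnat, ?_⟩
    rw [nextCoeff_of_natDegree_pos (by omega), hnat, coeff_add, coeff_add, coeff_X_pow,
      coeff_C_mul, coeff_X_pow, coeff_eq_zero_of_degree_lt hg]
    simp [show ¬ (m - 1 = m) by omega]

/-- Modulo `X ^ 2`, the reversal of a monic `f` is `1 + f.nextCoeff X`. -/
theorem bracket_one_eq_iff (α : F) {f : F[X]} (hf : f.Monic) : bracket 1 f = bracket 1 (X + C α) ↔ f.nextCoeff = α := by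
  rw [bracket, bracket, Ideal.Quotient.eq, Ideal.mem_span_singleton, X_pow_dvd_iff]
  have h0 : (f.reverse - (X + C α).reverse).coeff 0 = 0 := by
    rw [coeff_sub, coeff_zero_reverse, coeff_zero_reverse, hf.leadingCoeff,
      (monic_X_add_C α).leadingCoeff, sub_self]
  have h1 : (f.reverse - (X + C α).reverse).coeff 1 = f.nextCoeff - α := by
    rw [coeff_sub, coeff_one_reverse, coeff_one_reverse, nextCoeff_X_add_C]
  constructor
  · intro h
    exact sub_eq_zero.1 (h1 ▸ h 1 (by norm_num))
  · intro h d hd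
    interval_cases d
    · exact h0
    · rw [h1, h, sub_self]

open Classical in
-- By convention `nextCoeff` is `0` on constants. This keeps second coefficients additive when a
-- cofactor is `1`.
theorem monicTrace_zero (α : F) : monicTrace 0 α = if α = 0 then {1} else ∅ := by
  ext f
  simp only [monicTrace, Set.mem_ofPred_eq]
  constructor
  · rintro ⟨h1, h2, h3⟩
    obtain rfl := h1.natDegree_eq_zero.1 h2
    have : α = 0 := by rw [← h3, nextCoeff, if_pos h2]
    simp [this]
  · split_ifs with h
    · rintro rfl
      simp [h, nextCoeff]
    · simp

variable [Finite F]

theorem finite_monicTrace (m : ℕ) (α : F) : (monicTrace m α).Finite :=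
  (finite_natDegree_eq m).subset fun _ h => h.2.1

omit [Finite F] in
theorem ncard_monicTrace {m : ℕ} (hm : 1 ≤ m) (α : F) :
    (monicTrace m α).ncard = Nat.card F ^ (m - 1) := by
  have himg : monicTrace m α = (fun g => X ^ m + C α * X ^ (m - 1) + g) ''
      ((degreeLT F (m - 1) : Submodule F F[X]) : Set F[X]) := by
    ext f
    rw [mem_monicTrace_iff hm]
    simp only [Set.mem_image, SetLike.mem_coe, mem_degreeLT, degree_add_two_le_iff hm]
    exact exists_congr fun g => and_congr_right fun _ => eq_comm
  rw [himg, Set.ncard_image_of_injective _ (add_right_injective _), ← Nat.card_coe_set_eq]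
  refine (Nat.card_congr (degreeLTEquiv F (m - 1)).toEquiv).trans ?_
  rw [Nat.card_fun, Nat.card_fin]

omit [Finite F] in
theorem ncard_monicTrace_dvd_of_le {m : ℕ} (α : F) {D : F[X]} (hD : D.Monic)
    (hd : D.natDegree ≤ m) :
    {f ∈ monicTrace m α | D ∣ f}.ncard =
      (monicTrace (m - D.natDegree) (α - D.nextCoeff)).ncard := by
  have himg : {f ∈ monicTrace m α | D ∣ f} =
      (fun h => D * h) '' monicTrace (m - D.natDegree) (α - D.nextCoeff) := by
    ext f
    constructor
    · rintro ⟨⟨h1, h2, h3⟩, h, rfl⟩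
      have hh : h.Monic := hD.of_mul_monic_left h1
      rw [hD.natDegree_mul hh] at h2
      rw [hD.nextCoeff_mul hh] at h3
      exact ⟨h, ⟨hh, by omega, by rw [← h3]; ring⟩, rfl⟩
    · rintro ⟨h, ⟨h1, h2, h3⟩, rfl⟩
      refine ⟨⟨hD.mul h1, ?_, ?_⟩, dvd_mul_right _ _⟩
      · rw [hD.natDegree_mul h1]; omega
      · rw [hD.nextCoeff_mul h1, h3]; ring
  rw [himg, Set.ncard_image_of_injective _ (mul_right_injective₀ hD.ne_zero)]

open Classical in
-- Dividing by `D` lowers the degree and shifts the second coefficient. The uniform count would be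
-- `1 / q` at `deg D = m`, where the true count is `0` or `1`; the second term corrects this.
theorem ncard_monicTrace_dvd {m : ℕ} (hm : 1 ≤ m) (α : F) {D : F[X]} (hD : D.Monic) :
    ({f ∈ monicTrace m α | D ∣ f}.ncard : ℚ) =
      (if D.natDegree ≤ m then
        (Nat.card F : ℚ) ^ (m - 1) * (Nat.card F : ℚ) ^ (-(D.natDegree : ℤ)) else 0) +
      (if D.natDegree = m then
        (if D.nextCoeff = α then (1 : ℚ) else 0) - 1 / (Nat.card F : ℚ) else 0) := by
  have hq : (Nat.card F : ℚ) ≠ 0 := Nat.cast_ne_zero.2 Nat.card_pos.ne'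
  rcases lt_trichotomy D.natDegree m with hlt | heq | hgt
  · rw [ncard_monicTrace_dvd_of_le α hD hlt.le, ncard_monicTrace (by omega), if_pos hlt.le,
      if_neg hlt.ne, add_zero, zpow_neg, zpow_natCast, ← div_eq_mul_inv, eq_div_iff (by positivity)]
    push_cast
    rw [← pow_add]
    congr 1
    omega
  · rw [ncard_monicTrace_dvd_of_le α hD heq.le, heq, Nat.sub_self, monicTrace_zero, if_pos le_rfl,
      if_pos rfl, zpow_neg, zpow_natCast]
    have h1 : (Nat.card F : ℚ) ^ (m - 1) * ((Nat.card F : ℚ) ^ m)⁻¹ = 1 / Nat.card F := by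
      obtain ⟨l, rfl⟩ := Nat.exists_eq_add_of_le' hm
      rw [Nat.add_sub_cancel]
      field_simp
      ring
    rw [h1, add_sub_cancel]
    simp only [sub_eq_zero, eq_comm (a := α)]
    split_ifs <;> simp
  · rw [if_neg (by omega), if_neg (by omega)]
    have : {f ∈ monicTrace m α | D ∣ f} = ∅ := by
      ext f
      simp only [Set.mem_ofPred_eq, Set.mem_empty_iff_false, iff_false]
      rintro ⟨⟨h1, h2, -⟩, hdvd⟩
      have := natDegree_le_of_dvd hdvd h1.ne_zero
      omega
    simp [this]

/-- The polynomials in `monicTrace m α` without irreducible factor of degree in `n + 1, …, m`. -/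
def sievedTrace (n m : ℕ) (α : F) : Set F[X] :=
  {f ∈ monicTrace m α | ∀ i : ↥(Finset.Icc (n + 1) m), ∀ P ∈ irredFinset F i, ¬ P ∣ f}

theorem smoothWithTrace_eq_sievedTrace {m : ℕ} (hm : 1 ≤ m) (n : ℕ) (α : F) :
    smoothWithTrace n m α = sievedTrace n m α := by
  ext f
  simp only [smoothWithTrace, sievedTrace, Set.mem_ofPred_eq, ← mem_monicTrace_iff hm]
  rw [and_comm]
  refine and_congr_right fun hf => ⟨fun h i P hP hdvd => ?_, fun h P hP hdvd => ?_⟩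
  · rw [mem_irredFinset] at hP
    have h1 := h P hP.2.1 hdvd
    have h2 := (Finset.mem_Icc.1 i.2).1
    omega
  · by_contra! hlt
    have hle : P.natDegree ≤ m := hf.2.1 ▸ natDegree_le_of_dvd hdvd hf.1.ne_zero
    have h0 := hP.ne_zero
    -- Smoothness tests all irreducible factors, the sieve only monic ones, so `P` is normalized.
    refine h ⟨P.natDegree, Finset.mem_Icc.2 ⟨hlt, hle⟩⟩ (P * C P.leadingCoeff⁻¹) ?_ ?_
    · rw [mem_irredFinset]
      refine ⟨monic_mul_leadingCoeff_inv h0, irreducible_mul_leadingCoeff_inv.2 hP, ?_⟩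
      exact natDegree_mul_leadingCoeff_inv P h0
    · exact ((isUnit_C.2 (isUnit_iff_ne_zero.2
        (inv_ne_zero (leadingCoeff_ne_zero.2 h0)))).mul_right_dvd).2 hdvd

theorem numPattern_eq_ncard_sievedTrace (n m : ℕ) (α : F) :
    numPattern 1 m (Finset.Icc (n + 1) m) (fun _ => 0) (X + C α) =
      (sievedTrace n m α).ncard := by
  rw [numPattern]
  congr 1
  ext f
  have hzero : ∀ i, numDistinct i f = 0 ↔ ∀ P ∈ irredFinset F i, ¬ P ∣ f := fun i => by
    rw [numDistinct, Set.ncard_eq_zero ((finite_monicIrred i).subset fun _ h => h.1),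
      Set.eq_empty_iff_forall_notMem]
    refine forall_congr' fun P => ?_
    simp only [Set.mem_ofPred_eq, not_and, irredFinset, Set.Finite.mem_toFinset]
  simp only [Set.mem_ofPred_eq, sievedTrace, monicTrace, hzero, Subtype.forall]
  constructor
  · rintro ⟨h1, h2, h3, h4⟩
    exact ⟨⟨h1, h2, (bracket_one_eq_iff α h1).1 h3⟩, h4⟩
  · rintro ⟨⟨h1, h2, h3⟩, h4⟩
    exact ⟨h1, h2, (bracket_one_eq_iff α h1).2 h3, h4⟩

end MonicCount

/-! ### Inclusion-exclusion and the two sums. -/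

section Sieve

/-- Families are grouped by their cardinalities, on which alone `φ` depends; within a group the sum
of products factors. `L` only bounds the index set. -/
theorem sum_piFinset_powerset_ite {ι α R : Type*} [Fintype ι] [DecidableEq ι] [CommSemiring R]
    (Q : ι → Finset α) (L : ι → ℕ) (φ : (ι → ℕ) → Prop) [DecidablePred φ]
    (g : ι → Finset α → R)
    (hφ : ∀ S ∈ Fintype.piFinset fun i => (Q i).powerset,
      φ (fun i => (S i).card) → ∀ i, (S i).card ≤ L i) :
    (∑ S ∈ Fintype.piFinset fun i => (Q i).powerset,
      if φ (fun i => (S i).card) then ∏ i, g i (S i) else 0) =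
    ∑ k ∈ Fintype.piFinset fun i => Finset.range (L i + 1),
      if φ k then ∏ i, ∑ t ∈ (Q i).powersetCard (k i), g i t else 0 := by
  classical
  rw [← Finset.sum_filter, ← Finset.sum_fiberwise_of_maps_to
    (t := Fintype.piFinset fun i => Finset.range (L i + 1))
    (g := fun (S : ι → Finset α) i => (S i).card)]
  · refine Finset.sum_congr rfl fun k hk => ?_
    split_ifs with h
    · rw [Finset.prod_univ_sum]
      refine Finset.sum_congr ?_ fun _ _ => rfl
      ext S
      simp only [Finset.mem_filter, Fintype.mem_piFinset, Finset.mem_powerset,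
        Finset.mem_powersetCard]
      constructor
      · rintro ⟨⟨h1, -⟩, rfl⟩
        exact fun i => ⟨h1 i, rfl⟩
      · intro hS
        obtain rfl : (fun i => (S i).card) = k := funext fun i => (hS i).2
        exact ⟨⟨fun i => (hS i).1, h⟩, rfl⟩
    · refine Finset.sum_eq_zero fun S hS => ?_
      simp only [Finset.mem_filter] at hS
      exact absurd (hS.2 ▸ hS.1.2) h
  · intro S hS
    rw [Finset.mem_filter] at hS
    rw [Fintype.mem_piFinset]
    exact fun i => Finset.mem_range.2 (Nat.lt_succ_of_le (hφ S hS.1 hS.2 i))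

variable {F : Type*} [Field F] [Finite F]

theorem isCoprime_of_mem_irredFinset {i j : ℕ} {P R : F[X]} (hP : P ∈ irredFinset F i)
    (hR : R ∈ irredFinset F j) (hne : P ≠ R) : IsCoprime P R := by
  rw [mem_irredFinset] at hP hR
  refine (hP.2.1.coprime_iff_not_dvd).2 fun hdvd => hne ?_
  exact eq_of_monic_of_associated hP.1 hR.1 (hP.2.1.associated_of_dvd hR.2.1 hdvd)

variable {n m : ℕ}

theorem prod_prod_dvd_iff {S : ↥(Finset.Icc (n + 1) m) → Finset F[X]}
    (hS : ∀ i, S i ⊆ irredFinset F i) (f : F[X]) :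
    (∏ i, ∏ P ∈ S i, P) ∣ f ↔ ∀ i, ∀ P ∈ S i, P ∣ f := by
  constructor
  · intro h i P hP
    exact (Finset.dvd_prod_of_mem _ hP).trans
      ((Finset.dvd_prod_of_mem (fun i => ∏ P ∈ S i, P) (Finset.mem_univ i)).trans h)
  · intro h
    refine Finset.prod_dvd_of_coprime ?_ fun i _ => Finset.prod_dvd_of_coprime ?_ fun P hP => h i P hP
    · intro i _ j _ hij
      refine IsCoprime.prod_left fun P hP => IsCoprime.prod_right fun R hR => ?_
      refine isCoprime_of_mem_irredFinset (hS i hP) (hS j hR) fun hPR => hij ?_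
      have h1 := (mem_irredFinset.1 (hS i hP)).2.2
      have h2 := (mem_irredFinset.1 (hS j hR)).2.2
      exact Subtype.ext (by rw [← h1, ← h2, hPR])
    · intro P hP R hR hne
      exact isCoprime_of_mem_irredFinset (hS i hP) (hS i hR) hne

theorem monic_prod_prod {S : ↥(Finset.Icc (n + 1) m) → Finset F[X]}
    (hS : ∀ i, S i ⊆ irredFinset F i) : (∏ i, ∏ P ∈ S i, P).Monic :=
  monic_prod_of_monic _ _ fun i _ => monic_prod_of_monic _ _ fun _ hP =>
    (mem_irredFinset.1 (hS i hP)).1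

theorem natDegree_prod_prod {S : ↥(Finset.Icc (n + 1) m) → Finset F[X]}
    (hS : ∀ i, S i ⊆ irredFinset F i) :
    (∏ i, ∏ P ∈ S i, P).natDegree = ∑ i : ↥(Finset.Icc (n + 1) m), (i : ℕ) * (S i).card := by
  rw [natDegree_prod_of_monic _ _ fun i _ => monic_prod_of_monic _ _ fun _ hP =>
    (mem_irredFinset.1 (hS i hP)).1]
  refine Finset.sum_congr rfl fun i _ => ?_
  rw [natDegree_prod_of_monic _ _ fun P hP => (mem_irredFinset.1 (hS i hP)).1,
    Finset.sum_congr rfl fun P hP => (mem_irredFinset.1 (hS i hP)).2.2, Finset.sum_const,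
    smul_eq_mul, mul_comm]

theorem nextCoeff_prod_prod {S : ↥(Finset.Icc (n + 1) m) → Finset F[X]}
    (hS : ∀ i, S i ⊆ irredFinset F i) :
    (∏ i, ∏ P ∈ S i, P).nextCoeff = ∑ i, ∑ P ∈ S i, P.nextCoeff := by
  rw [Monic.nextCoeff_prod _ _ fun i _ => monic_prod_of_monic _ _ fun _ hP =>
    (mem_irredFinset.1 (hS i hP)).1]
  exact Finset.sum_congr rfl fun i _ =>
    Monic.nextCoeff_prod _ _ fun P hP => (mem_irredFinset.1 (hS i hP)).1

variable (F n m) in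
/-- The families of sets of monic irreducible polynomials, one set for each degree. -/
def irredFamilies : Finset (↥(Finset.Icc (n + 1) m) → Finset F[X]) :=
  Fintype.piFinset fun i => (irredFinset F i).powerset

theorem mem_irredFamilies {S : ↥(Finset.Icc (n + 1) m) → Finset F[X]} :
    S ∈ irredFamilies F n m ↔ ∀ i, S i ⊆ irredFinset F i := by
  simp [irredFamilies]

open Classical in
-- The product of all `1 - [P ∣ f]` is expanded; coprimality merges the conditions on single factors
-- into divisibility by their product.
theorem ite_not_dvd_eq_sum (f : F[X]) :
    (if ∀ i : ↥(Finset.Icc (n + 1) m), ∀ P ∈ irredFinset F i, ¬ P ∣ f then (1 : ℚ) else 0) =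
      ∑ S ∈ irredFamilies F n m,
        (∏ i, (-1) ^ (S i).card) * if (∏ i, ∏ P ∈ S i, P) ∣ f then (1 : ℚ) else 0 := by
  have h1 : (if ∀ i : ↥(Finset.Icc (n + 1) m), ∀ P ∈ irredFinset F i, ¬ P ∣ f
      then (1 : ℚ) else 0) =
      ∏ i : ↥(Finset.Icc (n + 1) m), ∏ P ∈ irredFinset F i,
        (1 + if P ∣ f then (-1 : ℚ) else 0) := by
    split_ifs with h
    · symm
      refine Finset.prod_eq_one fun i _ => Finset.prod_eq_one fun P hP => ?_
      rw [if_neg (h i P hP), add_zero]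
    · push Not at h
      obtain ⟨i, P, hP, hdvd⟩ := h
      symm
      refine Finset.prod_eq_zero (Finset.mem_univ i) (Finset.prod_eq_zero hP ?_)
      rw [if_pos hdvd]
      norm_num
  rw [h1, Finset.prod_congr rfl fun i _ => Finset.prod_one_add _, Finset.prod_univ_sum]
  refine Finset.sum_congr rfl fun S hS => ?_
  have hS' : ∀ i, S i ⊆ irredFinset F i := mem_irredFamilies.1 hS
  by_cases h : (∏ i, ∏ P ∈ S i, P) ∣ f
  · rw [if_pos h, mul_one]
    rw [prod_prod_dvd_iff hS'] at h
    refine Finset.prod_congr rfl fun i _ => ?_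
    rw [← Finset.prod_const]
    exact Finset.prod_congr rfl fun P hP => if_pos (h i P hP)
  · rw [if_neg h, mul_zero]
    rw [prod_prod_dvd_iff hS'] at h
    push Not at h
    obtain ⟨i, P, hP, hdvd⟩ := h
    exact Finset.prod_eq_zero (Finset.mem_univ i) (Finset.prod_eq_zero hP (if_neg hdvd))

open Classical in
theorem ncard_sievedTrace_eq_sum (α : F) :
    ((sievedTrace n m α).ncard : ℚ) = ∑ S ∈ irredFamilies F n m,
      (∏ i, (-1) ^ (S i).card) *
        ({f ∈ monicTrace m α | (∏ i, ∏ P ∈ S i, P) ∣ f}.ncard : ℚ) := by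
  have hcard : ∀ p : F[X] → Prop, ({f ∈ monicTrace m α | p f}.ncard : ℚ) =
      ∑ f ∈ (finite_monicTrace m α).toFinset, if p f then (1 : ℚ) else 0 := fun p => by
    rw [Finset.sum_boole, ← Set.ncard_coe_finset]
    congr 2
    ext f
    simp
  have hsum : ((sievedTrace n m α).ncard : ℚ) = ∑ f ∈ (finite_monicTrace m α).toFinset,
      ∑ S ∈ irredFamilies F n m,
        (∏ i, (-1) ^ (S i).card) * if (∏ i, ∏ P ∈ S i, P) ∣ f then (1 : ℚ) else 0 := by
    rw [sievedTrace, hcard]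
    refine Finset.sum_congr rfl fun f _ => ?_
    exact Eq.trans (by congr) (ite_not_dvd_eq_sum f)
  rw [hsum, Finset.sum_comm]
  refine Finset.sum_congr rfl fun S _ => ?_
  rw [hcard, Finset.mul_sum]

theorem sum_irredFamilies_degree_le :
    (∑ S ∈ irredFamilies F n m, if ∑ i : ↥(Finset.Icc (n + 1) m), (i : ℕ) * (S i).card ≤ m then
      (∏ i, (-1 : ℚ) ^ (S i).card) *
        (Nat.card F : ℚ) ^ (-((∑ i : ↥(Finset.Icc (n + 1) m), (i : ℕ) * (S i).card : ℕ) : ℤ)) else 0) =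
    ∑ j ∈ Fintype.piFinset (fun i : ↥(Finset.Icc (n + 1) m) =>
        Finset.range ((monicIrred F i).ncard + 1)),
      if ∑ i : ↥(Finset.Icc (n + 1) m), (i : ℕ) * j i ≤ m then
        ∏ i : ↥(Finset.Icc (n + 1) m), (Nat.card F : ℚ) ^ (-(((i : ℕ) * j i : ℕ) : ℤ)) *
          ((monicIrred F i).ncard.choose (j i) : ℚ) * (-1) ^ (j i)
      else 0 := by
  have h := sum_piFinset_powerset_ite (fun i : ↥(Finset.Icc (n + 1) m) => irredFinset F i)
    (fun i => (monicIrred F i).ncard) (fun k => ∑ i : ↥(Finset.Icc (n + 1) m), (i : ℕ) * k i ≤ m)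
    (fun i t => (-1 : ℚ) ^ t.card * (Nat.card F : ℚ) ^ (-(((i : ℕ) * t.card : ℕ) : ℤ)))
    (fun S hS _ i => by
      rw [← card_irredFinset]
      exact Finset.card_le_card (mem_irredFamilies.1 hS i))
  refine Eq.trans (Finset.sum_congr rfl fun S _ => ?_) (h.trans (Finset.sum_congr rfl fun k _ => ?_))
  · refine if_congr Iff.rfl ?_ rfl
    rw [Finset.prod_mul_distrib]
    congr 1
    simp only [zpow_neg, zpow_natCast]
    rw [Finset.prod_inv_distrib, Finset.prod_pow_eq_pow_sum]
  · refine if_congr Iff.rfl (Finset.prod_congr rfl fun i _ => ?_) rfl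
    rw [Finset.sum_congr rfl fun t ht => by rw [(Finset.mem_powersetCard.1 ht).2],
      Finset.sum_const, Finset.card_powersetCard, card_irredFinset, nsmul_eq_mul]
    ring

theorem addChar_map_sum {ι A M : Type*} [AddCommMonoid A] [CommMonoid M] (χ : AddChar A M)
    (s : Finset ι) (f : ι → A) : χ (∑ i ∈ s, f i) = ∏ i ∈ s, χ (f i) := by
  classical
  induction s using Finset.induction_on with
  | empty => simp
  | insert i s hi ih => rw [Finset.sum_insert hi, Finset.prod_insert hi, χ.map_add_eq_mul, ih]

/-- `χ` turns the additive second coefficient into a product over degrees. The value is the same for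
every nontrivial `χ`, so it can later be pulled out of the character sum. -/
theorem sum_irredFamilies_addChar {p e : ℕ} (hp : p.Prime) (he : 0 < e)
    (hF : Nat.card F = p ^ e) [CharP F p] {χ : AddChar F ℂ} (hχ : χ ≠ 1) :
    (∑ S ∈ irredFamilies F n m, if ∑ i : ↥(Finset.Icc (n + 1) m), (i : ℕ) * (S i).card = m then
      (∏ i, (-1 : ℂ) ^ (S i).card) * χ (∏ i, ∏ P ∈ S i, P).nextCoeff else 0) =
    ((∑ k ∈ Fintype.piFinset (fun _ : ↥(Finset.Icc (n + 1) m) => Finset.range (m + 1)),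
      if ∑ i : ↥(Finset.Icc (n + 1) m), (i : ℕ) * k i = m then
        ∏ i : ↥(Finset.Icc (n + 1) m), numA p (Nat.card F) (k i) (aCoeff p (Nat.card F) i)
          (bCoeff p (Nat.card F) i) * (-1) ^ (k i)
      else 0 : ℚ) : ℂ) := by
  have h := sum_piFinset_powerset_ite (fun i : ↥(Finset.Icc (n + 1) m) => irredFinset F i)
    (fun _ => m) (fun k => ∑ i : ↥(Finset.Icc (n + 1) m), (i : ℕ) * k i = m)
    (fun i t => ∏ P ∈ t, -χ P.nextCoeff)
    (fun S hS hsum i => by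
      have h1 := Finset.single_le_sum (f := fun i : ↥(Finset.Icc (n + 1) m) => (i : ℕ) * (S i).card)
        (fun _ _ => Nat.zero_le _) (Finset.mem_univ i)
      have h2 := (Finset.mem_Icc.1 i.2).1
      calc (S i).card ≤ (i : ℕ) * (S i).card := Nat.le_mul_of_pos_left _ (by omega)
        _ ≤ _ := h1
        _ = m := hsum)
  refine Eq.trans (Finset.sum_congr rfl fun S hS => ?_) (h.trans ?_)
  · refine if_congr Iff.rfl ?_ rfl
    rw [nextCoeff_prod_prod (mem_irredFamilies.1 hS), addChar_map_sum,
      ← Finset.prod_mul_distrib]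
    refine Finset.prod_congr rfl fun i _ => ?_
    rw [addChar_map_sum, Finset.prod_neg]
  · rw [Rat.cast_sum]
    refine Finset.sum_congr rfl fun k _ => ?_
    split_ifs
    · rw [Rat.cast_prod]
      refine Finset.prod_congr rfl fun i _ => ?_
      have hi := (Finset.mem_Icc.1 i.2).1
      rw [← prod_irredFinset_one_sub hp he hF hχ (by omega : 0 < (i : ℕ)),
        coeff_prod_one_sub_C_mul_X]
    · simp

open Classical in
theorem sum_addChar_erase_one [Fintype F] (x : F) :
    ∑ χ ∈ (Finset.univ : Finset (AddChar F ℂ)).erase 1, χ x =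
      (if x = 0 then (Nat.card F : ℂ) else 0) - 1 := by
  have h := AddChar.sum_apply_eq_ite x
  rw [← Finset.add_sum_erase _ _ (Finset.mem_univ (1 : AddChar F ℂ)), AddChar.one_apply] at h
  rw [Nat.card_eq_fintype_card, ← h]
  ring

open Classical in
theorem sum_irredFamilies_degree_eq {p e : ℕ} (hp : p.Prime) (he : 0 < e)
    (hF : Nat.card F = p ^ e) [CharP F p] (α : F) :
    (∑ S ∈ irredFamilies F n m, if ∑ i : ↥(Finset.Icc (n + 1) m), (i : ℕ) * (S i).card = m then
      (∏ i, (-1 : ℚ) ^ (S i).card) * ((if (∏ i, ∏ P ∈ S i, P).nextCoeff = α then (1 : ℚ) else 0) -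
        1 / (Nat.card F : ℚ)) else 0) =
    traceSign (Nat.card F) α / (Nat.card F : ℚ) *
      (∑ k ∈ Fintype.piFinset (fun _ : ↥(Finset.Icc (n + 1) m) => Finset.range (m + 1)),
      if ∑ i : ↥(Finset.Icc (n + 1) m), (i : ℕ) * k i = m then
        ∏ i : ↥(Finset.Icc (n + 1) m), numA p (Nat.card F) (k i) (aCoeff p (Nat.card F) i)
          (bCoeff p (Nat.card F) i) * (-1) ^ (k i)
      else 0) := by
  have : Fintype F := Fintype.ofFinite F
  have hq : (Nat.card F : ℂ) ≠ 0 := Nat.cast_ne_zero.2 Nat.card_pos.ne'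
  set W : ℚ := ∑ k ∈ Fintype.piFinset (fun _ : ↥(Finset.Icc (n + 1) m) => Finset.range (m + 1)),
      if ∑ i : ↥(Finset.Icc (n + 1) m), (i : ℕ) * k i = m then
        ∏ i : ↥(Finset.Icc (n + 1) m), numA p (Nat.card F) (k i) (aCoeff p (Nat.card F) i)
          (bCoeff p (Nat.card F) i) * (-1) ^ (k i)
      else 0 with hW
  have hsign : ((traceSign (Nat.card F) α : ℚ) : ℂ) =
      ∑ χ ∈ (Finset.univ : Finset (AddChar F ℂ)).erase 1, χ (-α) := by
    rw [sum_addChar_erase_one, traceSign]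
    by_cases hα : α = 0 <;> simp [hα]
  have hind : ∀ y : F, ((((if y = α then (1 : ℚ) else 0) - 1 / (Nat.card F : ℚ) : ℚ)) : ℂ) =
      (∑ χ ∈ (Finset.univ : Finset (AddChar F ℂ)).erase 1, χ (-α) * χ y) / Nat.card F := fun y => by
    have h1 : ∀ χ ∈ (Finset.univ : Finset (AddChar F ℂ)).erase 1, χ (-α) * χ y = χ (y - α) :=
      fun χ _ => by rw [← AddChar.map_add_eq_mul, neg_add_eq_sub]
    rw [Finset.sum_congr rfl h1, sum_addChar_erase_one, sub_div]
    by_cases hy : y = α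
    · simp [hy]
    · simp [hy, sub_eq_zero]
  have hcast : Function.Injective (Rat.cast : ℚ → ℂ) := Rat.cast_injective
  -- The identity is rational, but characters take values in `ℂ`, so it is checked there.
  apply hcast
  rw [Rat.cast_mul, Rat.cast_div, hsign, Rat.cast_natCast, div_mul_eq_mul_div, Finset.sum_mul,
    Finset.sum_congr (s₁ := (Finset.univ : Finset (AddChar F ℂ)).erase 1) rfl fun χ hχ => by
      rw [hW, ← sum_irredFamilies_addChar (n := n) (m := m) hp he hF (Finset.ne_of_mem_erase hχ),
        Finset.mul_sum], Finset.sum_comm, Finset.sum_div, Rat.cast_sum]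
  refine Finset.sum_congr rfl fun S _ => ?_
  by_cases hdeg : ∑ i : ↥(Finset.Icc (n + 1) m), (i : ℕ) * (S i).card = m
  · simp only [if_pos hdeg]
    rw [Rat.cast_mul, hind, mul_div_assoc', Finset.mul_sum]
    push_cast
    congr 1
    exact Finset.sum_congr rfl fun χ _ => by ring
  · simp only [if_neg hdeg]
    simp

end Sieve

end
end SmoothCount

theorem corollary7p5 {F : Type*} [Field F] [Finite F] (p e q : ℕ) (hp : p.Prime) (he : 0 < e)
    (hq : q = p ^ e) (hF : Nat.card F = q) (n m : ℕ) (hm : 1 ≤ m) (α : F) :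
    (SmoothCount.smoothWithTrace n m α).ncard =
        SmoothCount.numPattern 1 m (Finset.Icc (n + 1) m) (fun _ => 0) (X + C α) ∧
      ((SmoothCount.smoothWithTrace n m α).ncard : ℚ) =
        (q : ℚ) ^ (m - 1) *
            (∑ j ∈ Fintype.piFinset (fun i : ↥(Finset.Icc (n + 1) m) =>
                Finset.range ((SmoothCount.monicIrred F i).ncard + 1)),
              if ∑ i : ↥(Finset.Icc (n + 1) m), (i : ℕ) * j i ≤ m then
                ∏ i : ↥(Finset.Icc (n + 1) m), (q : ℚ) ^ (-(((i : ℕ) * j i : ℕ) : ℤ)) *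
                  ((SmoothCount.monicIrred F i).ncard.choose (j i) : ℚ) * (-1) ^ (j i)
              else 0) +
          SmoothCount.traceSign q α / (q : ℚ) *
            -- the condition on the sum forces every `k i` to be at most `m`
            (∑ k ∈ Fintype.piFinset (fun _ : ↥(Finset.Icc (n + 1) m) => Finset.range (m + 1)),
              if ∑ i : ↥(Finset.Icc (n + 1) m), (i : ℕ) * k i = m then
                ∏ i : ↥(Finset.Icc (n + 1) m), SmoothCount.numA p q (k i) (SmoothCount.aCoeff p q i)
                  (SmoothCount.bCoeff p q i) * (-1) ^ (k i)
              else 0) := by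
  have hpF : Nat.card F = p ^ e := hF.trans hq
  have hchar : CharP F p := by
    obtain ⟨r, hr⟩ := CharP.exists F
    have : Fintype F := Fintype.ofFinite F
    obtain ⟨k, hr', hk⟩ := FiniteField.card F r
    rw [← Nat.card_eq_fintype_card, hpF] at hk
    have hpr : p = r :=
      (Nat.prime_dvd_prime_iff_eq hp hr').1 (hp.dvd_of_dvd_pow (hk ▸ dvd_pow_self p he.ne'))
    rwa [hpr]
  clear hq
  subst hF
  rw [SmoothCount.smoothWithTrace_eq_sievedTrace hm]
  refine ⟨(SmoothCount.numPattern_eq_ncard_sievedTrace n m α).symm, ?_⟩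
  -- Both closed forms are turned back into sums over families, so that the identity holds term by
  -- term.
  rw [← SmoothCount.sum_irredFamilies_degree_le, ← SmoothCount.sum_irredFamilies_degree_eq hp he hpF,
    SmoothCount.ncard_sievedTrace_eq_sum, Finset.mul_sum, ← Finset.sum_add_distrib]
  refine Finset.sum_congr rfl fun S hS => ?_
  rw [SmoothCount.mem_irredFamilies] at hS
  rw [SmoothCount.ncard_monicTrace_dvd hm α (SmoothCount.monic_prod_prod hS),
    SmoothCount.natDegree_prod_prod hS, mul_add]
  congr 1
  · rw [mul_ite, mul_ite, mul_zero, mul_zero]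
    exact if_congr Iff.rfl (by ring) rfl
  · rw [mul_ite, mul_zero]
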